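/- Let $n\ge 2$ and let $f:\mathbb{R}^n\to\mathbb{R}$ be a $C^\infty$ submersion. Denote by $\mathscr{F}(f)$ the foliation of $\mathbb{R}^n$ whose leaves are the connected components of the level sets of $f$. A set $\mathcal{B}\subset\mathbb{R}^n$ is called a mild half-Reeb component of $\mathscr{F}(f)$ if $\mathcal{B}=\overline{\bigcup_{k\in\mathbb{N}}P_k}$, where each $P_k$ is a bounded connected open set whose boundary is $C^1$ by parts and is the union of a subset $Q_k$ of a leaf of $\mathscr{F}(f)$ and a hypersurface $L_k$ of $\mathbb{R}^n$, where $P_k\subset P_{k+1}$ for all $k$, and where there exists a bounded hypersurface $L$ of $\mathbb{R}^n$ such that $L_k\subset L_{k+1}\subset L$ for all $k$. (Here a hypersurface is allowed to have a boundary and to be only $C^1$ by parts: a set $S\subset\mathbb{R}^n$ is such a hypersurface if its regular points, near which $S$ is the zero set of a $C^1$ function with nowhere vanishing differential, are dense in $S$, and its other points form a set of $(n-1)$-dimensional Hausdorff measure zero. The boundary of $P_k$ is $C^1$ by parts if it is a hypersurface in this sense.) Let $\mathcal{B}$ be a mild half-Reeb component of $\mathscr{F}(f)$, let $U\subset\mathbb{R}^n$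 be an open neighbourhood of $\mathcal{B}$, and let $h:U\to[0,\infty)$ be a $C^\infty$ function such that $\int_{\mathcal{B}}h=\infty$. Then there exists no $C^\infty$ map $F=(f_1,\dots,f_n):U\to\mathbb{R}^n$ such that $f_1=f$ and $\det DF=h$ in $U$. -/

import Mathlib

open MeasureTheory Set
open scoped ContDiff

/-- `x` is a regular point of `S ⊆ ℝⁿ`: near `x`, the set `S` is the zero set of a `C¹` function
without critical points, that is, an embedded `C¹` hypersurface without boundary. -/
def IsC1RegularPoint {n : ℕ} (S : Set (EuclideanSpace ℝ (Fin n)))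
    (x : EuclideanSpace ℝ (Fin n)) : Prop :=
  ∃ (V : Set (EuclideanSpace ℝ (Fin n))) (g : EuclideanSpace ℝ (Fin n) → ℝ),
    IsOpen V ∧ x ∈ V ∧ ContDiffOn ℝ 1 g V ∧ (∀ y ∈ V, fderiv ℝ g y ≠ 0) ∧
      S ∩ V = {y ∈ V | g y = 0}

/-- A hypersurface of `ℝⁿ` which is `C¹` by parts. The points of `S` which are not regular (edges,
corners, points of the boundary of the hypersurface) form a set of `(n - 1)`-dimensional measure
zero, and every point of `S` is a limit of regular points of `S`. Embedded `C¹` hypersurfaces,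
with or without boundary or corners, compact or not, are included. -/
def IsPiecewiseC1Hypersurface {n : ℕ} (S : Set (EuclideanSpace ℝ (Fin n))) : Prop :=
  Measure.hausdorffMeasure ((n : ℝ) - 1) {x ∈ S | ¬ IsC1RegularPoint S x} = 0 ∧
    S ⊆ closure {x ∈ S | IsC1RegularPoint S x}

/-- `f : ℝⁿ → ℝ` is a `C^∞` submersion. -/
def IsSmoothSubmersion {n : ℕ} (f : EuclideanSpace ℝ (Fin n) → ℝ) : Prop :=
  ContDiff ℝ ∞ f ∧ ∀ x, Function.Surjective (fderiv ℝ f x)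

/-- The leaves of the foliation `𝓕(f)`: the connected components of the level sets of `f`. -/
def IsLeaf {n : ℕ} (f : EuclideanSpace ℝ (Fin n) → ℝ)
    (Λ : Set (EuclideanSpace ℝ (Fin n))) : Prop :=
  ∃ x, Λ = connectedComponentIn (f ⁻¹' {f x}) x

/-- `B` is a mild half-Reeb component of the foliation `𝓕(f)`. -/
def IsMildHalfReebComponent {n : ℕ} (f : EuclideanSpace ℝ (Fin n) → ℝ)
    (B : Set (EuclideanSpace ℝ (Fin n))) : Prop :=
  ∃ (P Q L : ℕ → Set (EuclideanSpace ℝ (Fin n))) (L' : Set (EuclideanSpace ℝ (Fin n))),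
    B = closure (⋃ k, P k) ∧
    (∀ k, Bornology.IsBounded (P k) ∧ IsConnected (P k) ∧ IsOpen (P k)) ∧
    (∀ k, IsPiecewiseC1Hypersurface (frontier (P k))) ∧
    (∀ k, frontier (P k) = Q k ∪ L k) ∧
    (∀ k, ∃ Λ, IsLeaf f Λ ∧ Q k ⊆ Λ) ∧
    (∀ k, IsPiecewiseC1Hypersurface (L k)) ∧
    (∀ k, P k ⊆ P (k + 1)) ∧
    IsPiecewiseC1Hypersurface L' ∧ Bornology.IsBounded L' ∧
    (∀ k, L k ⊆ L (k + 1) ∧ L k ⊆ L')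

/-! Suppose `F` exists. Then `h` is the Jacobian of `F`, that is `df₁ ∧ ⋯ ∧ dfₙ` with `f₁ = f`. By
Stokes, its integral over `P k` is a boundary integral of `± fⱼ` times the wedge of the other
differentials, for some `j ≠ 1` (available since `n ≥ 2`). On `Q k` the factor `df` vanishes, so
only `L k` contributes, and all the `L k` lie in one compact set `K`. This bounds the integrals over
`P k` uniformly in `k`, because `h ≥ 0`.

Cutoffs replace the boundary integral. With `χ = 1` near `K` and `ψ = 0` near the level of `Q k`,
the function `(1 - χ) ψ(f)`, extended by zero from `P k`, is a `C¹` test function. Integrating the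
Jacobian against it (`integral_mul_det_fderiv_add_eq_zero`) leaves only the `dχ` term, since the
`df` term repeats a row. The resulting bound depends neither on `k` nor on `ψ`
(`lintegral_one_sub_mul_det_le`), so `ψ` may tend to `1` off a null level set
(`exists_lintegral_det_le`).

Monotone convergence gives a finite integral over `⋃ k, P k`. The rest of `B` lies in `K`, where the
integral is finite, or in the frontier of the union outside `K`, which is null
(`measure_frontier_iUnion_diff_eq_zero`). So `∫_B h < ∞`, a contradiction. -/

/-! ### The Jacobian determinant as a null Lagrangian -/

section NullLagrangian

variable {E : Type*} [NormedAddCommGroup E] [NormedSpace ℝ E] [FiniteDimensional ℝ E]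

/-- A small Lipschitz perturbation of the identity, supported in `S`, is bijective and maps `S`
onto itself. -/
theorem bijOn_id_add_smul {G : E → E} {C : NNReal} (hG : LipschitzWith C G) {S : Set E}
    (hS : ∀ x ∉ S, G x = 0) {t : ℝ} (ht : 0 < t) (htC : t * C < 1) :
    BijOn (fun x => x + t • G x) S S := by
  have happ : ApproximatesLinearOn (fun x => x + t • G x)
      ((ContinuousLinearEquiv.refl ℝ E : E ≃L[ℝ] E) : E →L[ℝ] E) univ (t.toNNReal * C) := by
    intro x _ y _
    have h1 : x + t • G x - (y + t • G y) -
        ((ContinuousLinearEquiv.refl ℝ E : E ≃L[ℝ] E) : E →L[ℝ] E) (x - y)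
        = t • (G x - G y) := by
      simp [smul_sub]; abel
    have h2 := hG.dist_le_mul x y
    rw [dist_eq_norm, dist_eq_norm] at h2
    rw [h1, norm_smul, Real.norm_of_nonneg ht.le, NNReal.coe_mul, Real.coe_toNNReal _ ht.le,
      mul_assoc]
    gcongr
  have hc : Subsingleton E ∨ t.toNNReal * C <
      ‖((ContinuousLinearEquiv.refl ℝ E).symm : E →L[ℝ] E)‖₊⁻¹ := by
    rcases subsingleton_or_nontrivial E with h | h
    · exact Or.inl h
    · right
      have : ‖((ContinuousLinearEquiv.refl ℝ E).symm : E →L[ℝ] E)‖₊ = 1 := by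
        ext
        exact ContinuousLinearMap.norm_id
      rw [this, inv_one, ← NNReal.coe_lt_coe, NNReal.coe_mul, Real.coe_toNNReal _ ht.le]
      exact htC
  have hinj : Function.Injective (fun x => x + t • G x) := injOn_univ.1 (happ.injOn hc)
  have hsurj := happ.surjective hc
  refine ⟨fun x hx => ?_, hinj.injOn, fun y hy => ?_⟩
  -- Points outside `S` are fixed, so a point of `S` sent outside would share its image with that
  -- image, against injectivity.
  · by_contra hx'
    have h0 := hS _ hx'
    have : (fun x => x + t • G x) (x + t • G x) = (fun x => x + t • G x) x := by
      simp only [] at h0 ⊢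
      rw [h0]; simp
    have hxx := hinj this
    rw [← hxx] at hx
    exact hx' hx
  · obtain ⟨x, rfl⟩ := hsurj y
    by_cases hx : x ∈ S
    · exact ⟨x, hx, rfl⟩
    · simp only [hS x hx, smul_zero, add_zero] at hy
      exact absurd hy hx

/-- The determinant of a linear map is a fixed linear combination of the characteristic values
`det (s + A)` at given nodes; the same combination kills the top monomial. -/
theorem exists_det_eq_sum_det_smul_id_add (hE : 0 < Module.finrank ℝ E) (s₀ : ℝ) :
    ∃ (w s : ℕ → ℝ), (∀ j, s₀ < s j) ∧
      (∀ A : E →L[ℝ] E, A.det = ∑ j ∈ Finset.range (Module.finrank ℝ E + 1),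
        w j * (s j • ContinuousLinearMap.id ℝ E + A).det) ∧
      ∑ j ∈ Finset.range (Module.finrank ℝ E + 1), w j * s j ^ Module.finrank ℝ E = 0 := by
  classical
  set d := Module.finrank ℝ E
  set s : ℕ → ℝ := fun j => s₀ + 1 + j with hs
  have hinj : Set.InjOn s (Finset.range (d + 1)) := by
    intro i _ j _ hij
    simpa [hs] using hij
  -- Extrapolation to `0` from `d + 1` nodes. The characteristic polynomial of `-A` gives the
  -- determinant identity; `X ^ d`, which vanishes at `0` because `d > 0`, gives the relation on the
  -- weights.
  have hlag : ∀ p : Polynomial ℝ, p.natDegree ≤ d → p.eval 0 = ∑ j ∈ Finset.range (d + 1),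
      (Lagrange.basis (Finset.range (d + 1)) s j).eval 0 * p.eval (s j) := by
    intro p hp
    have hdeg : p.degree < (Finset.range (d + 1)).card := by
      rw [Finset.card_range]
      exact lt_of_le_of_lt (Polynomial.degree_le_of_natDegree_le hp) (by exact_mod_cast d.lt_succ_self)
    conv_lhs => rw [Lagrange.eq_interpolate hinj hdeg]
    rw [Lagrange.interpolate_apply, Polynomial.eval_finsetSum]
    exact Finset.sum_congr rfl fun j _ => by simp [mul_comm]
  refine ⟨fun j => (Lagrange.basis (Finset.range (d + 1)) s j).eval 0, s,
    fun j => by simp only [hs]; have : (0 : ℝ) ≤ j := by positivity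
                linarith, fun A => ?_, ?_⟩
  · let b := Module.finBasis ℝ E
    let M := LinearMap.toMatrix b b (-(A : E →ₗ[ℝ] E))
    have hev : ∀ r : ℝ, M.charpoly.eval r = (r • ContinuousLinearMap.id ℝ E + A).det := by
      intro r
      rw [Matrix.eval_charpoly, ContinuousLinearMap.det, ← LinearMap.det_toMatrix b]
      congr 1
      have : ((r • ContinuousLinearMap.id ℝ E + A : E →L[ℝ] E) : E →ₗ[ℝ] E)
          = r • LinearMap.id + (A : E →ₗ[ℝ] E) := rfl
      rw [this, map_add, map_smul, LinearMap.toMatrix_id]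
      simp [M, Matrix.scalar_apply, Matrix.smul_one_eq_diagonal]
    have h0 := hlag M.charpoly (by rw [Matrix.charpoly_natDegree_eq_dim]; simp [d])
    simp only [hev, zero_smul, zero_add] at h0
    exact h0
  · have := hlag (Polynomial.X ^ d) (by simp)
    simp only [Polynomial.eval_pow, Polynomial.eval_X, zero_pow hE.ne'] at this
    exact this.symm

variable [MeasurableSpace E] [BorelSpace E] (μ : Measure E) [μ.IsAddHaarMeasure]

/-- For small `t` the map `id + t G` permutes `S` and has positive Jacobian, so the change of
variables formula computes the volume of `S`. -/
theorem exists_setIntegral_det_id_add_smul_fderiv {G : E → E} (hG : ContDiff ℝ 1 G)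
    (hGc : HasCompactSupport G) {S : Set E} (hSm : MeasurableSet S)
    (hS : tsupport G ⊆ S) :
    ∃ δ > 0, ∀ t : ℝ, 0 < t → t < δ →
      ∫ x in S, (ContinuousLinearMap.id ℝ E + t • fderiv ℝ G x).det ∂μ = μ.real S := by
  obtain ⟨C, hC⟩ := ContDiff.lipschitzWith_of_hasCompactSupport hGc hG one_ne_zero
  have hcont : Continuous (fun A : E →L[ℝ] E => A.det) := ContinuousLinearMap.continuous_det
  have hpos : ∀ᶠ A in nhds (ContinuousLinearMap.id ℝ E), 0 < ContinuousLinearMap.det A := by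
    apply (hcont.tendsto _).eventually (lt_mem_nhds _)
    simp [ContinuousLinearMap.det]
  obtain ⟨ε, hε, hball⟩ := Metric.eventually_nhds_iff.1 hpos
  -- The first bound gives `t * C < 1`, hence bijectivity; the second keeps `id + t DG` where the
  -- determinant is positive. `C + 1` guards against `C = 0`.
  refine ⟨min (1 / (C + 1)) (ε / (C + 1)), by positivity, fun t ht htδ => ?_⟩
  have hC1 : (0 : ℝ) < C + 1 := by positivity
  have ht1 : t * (C + 1) < 1 := by
    have := lt_of_lt_of_le htδ (min_le_left _ _)
    rwa [lt_div_iff₀ hC1] at this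
  have ht2 : t * (C + 1) < ε := by
    have := lt_of_lt_of_le htδ (min_le_right _ _)
    rwa [lt_div_iff₀ hC1] at this
  have hbij := bijOn_id_add_smul hC (S := S)
    (fun x hx => image_eq_zero_of_notMem_tsupport (fun h => hx (hS h))) ht (by nlinarith)
  have hd : ∀ x ∈ S, HasFDerivWithinAt (fun x => x + t • G x)
      (ContinuousLinearMap.id ℝ E + t • fderiv ℝ G x) S x := fun x _ =>
    ((hasFDerivAt_id x).add
      (((hG.differentiable one_ne_zero) x).hasFDerivAt.const_smul t)).hasFDerivWithinAt
  have key := integral_image_eq_integral_abs_det_fderiv_smul μ hSm hd hbij.injOn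
    (fun _ => (1 : ℝ))
  rw [hbij.image_eq] at key
  simp only [smul_eq_mul, mul_one, integral_const, measureReal_restrict_apply MeasurableSet.univ,
    univ_inter] at key
  rw [key]
  refine setIntegral_congr_fun hSm fun x _ => ?_
  refine (abs_of_pos (hball ?_)).symm
  rw [dist_eq_norm, add_sub_cancel_left, norm_smul, Real.norm_of_nonneg ht.le]
  have hn : ‖fderiv ℝ G x‖ ≤ C := norm_fderiv_le_of_lipschitz ℝ hC
  nlinarith

/-- The Jacobian determinant of a compactly supported `C¹` self-map has integral zero. -/
theorem integral_det_fderiv_eq_zero (hE : 0 < Module.finrank ℝ E) {G : E → E}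
    (hG : ContDiff ℝ 1 G) (hGc : HasCompactSupport G) :
    ∫ x, (fderiv ℝ G x).det ∂μ = 0 := by
  have hcont : Continuous (fun A : E →L[ℝ] E => A.det) := ContinuousLinearMap.continuous_det
  have hDG : Continuous (fderiv ℝ G) := hG.continuous_fderiv one_ne_zero
  set S := tsupport G with hSdef
  have hSm : MeasurableSet S := (isClosed_tsupport G).measurableSet
  obtain ⟨δ, hδ, hint⟩ := exists_setIntegral_det_id_add_smul_fderiv μ hG hGc hSm subset_rfl
  -- Nodes above `1 / δ` have inverses `t = 1 / s j < δ`, and `det (s + DG) = s ^ d * det (1 + t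
  -- DG)`.
  obtain ⟨w, s, hs, hdet, hsum⟩ := exists_det_eq_sum_det_smul_id_add (E := E) hE (1 / δ)
  have hnode : ∀ j, ∫ x in S, (s j • ContinuousLinearMap.id ℝ E + fderiv ℝ G x).det ∂μ
      = s j ^ Module.finrank ℝ E * μ.real S := by
    intro j
    have hsj : 0 < s j := lt_trans (by positivity) (hs j)
    rw [← hint (s j)⁻¹ (inv_pos.2 hsj) (by
      rw [inv_lt_comm₀ hsj hδ, ← one_div]; exact hs j), ← integral_const_mul]
    refine integral_congr_ae (Filter.Eventually.of_forall fun x => ?_)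
    have : s j • ContinuousLinearMap.id ℝ E + fderiv ℝ G x
        = s j • (ContinuousLinearMap.id ℝ E + (s j)⁻¹ • fderiv ℝ G x) := by
      rw [smul_add, smul_smul, mul_inv_cancel₀ hsj.ne', one_smul]
    simp only [this, ContinuousLinearMap.det]
    exact LinearMap.det_smul _ _
  have hrestr : ∫ x, (fderiv ℝ G x).det ∂μ = ∫ x in S, (fderiv ℝ G x).det ∂μ := by
    refine (setIntegral_eq_integral_of_forall_compl_eq_zero fun x hx => ?_).symm
    have : fderiv ℝ G x = 0 := by
      by_contra hne
      exact hx (support_fderiv_subset ℝ hne)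
    rw [this, ContinuousLinearMap.det]
    exact (LinearMap.det_zero (A := ℝ) (M := E)).trans (zero_pow hE.ne')
  rw [hrestr, integral_congr_ae (Filter.Eventually.of_forall fun x => hdet (fderiv ℝ G x)),
    integral_finsetSum]
  · simp only [integral_const_mul, hnode]
    rw [← zero_mul (μ.real S), ← hsum, Finset.sum_mul]
    exact Finset.sum_congr rfl fun j _ => by ring
  · intro j _
    refine Integrable.const_mul ?_ _
    exact (hcont.comp (continuous_const.add hDG)).continuousOn.integrableOn_compact hGc

end NullLagrangian

/-! ### Flow boxes and null frontiers -/

section LevelSets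

variable {E : Type*} [NormedAddCommGroup E] [NormedSpace ℝ E] [FiniteDimensional ℝ E]

/-- Near a regular point, a local diffeomorphism turns a function into a linear form. -/
theorem exists_localDiffeo_straightening {f : E → ℝ} {x₀ : E} (hf : ContDiffAt ℝ 1 f x₀)
    (hx₀ : fderiv ℝ f x₀ ≠ 0) :
    ∃ (e : OpenPartialHomeomorph E E), x₀ ∈ e.source ∧
      (∀ x, fderiv ℝ f x₀ (e x) = f x) ∧
      ∀ᶠ y in nhds (e x₀), DifferentiableAt ℝ e.symm y := by
  set l := fderiv ℝ f x₀ with hl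
  obtain ⟨v, hv⟩ : ∃ v, l v = 1 := by
    obtain ⟨w, hw⟩ : ∃ w, l w ≠ 0 := by
      by_contra! hcon
      exact hx₀ (ContinuousLinearMap.ext hcon)
    exact ⟨(l w)⁻¹ • w, by simp [hw]⟩
  -- Since `l v = 1`, this gives `l ∘ φ = f`; since `l` is the derivative of `f` at `x₀`, that of
  -- `φ` there is the identity.
  set φ : E → E := fun x => x + (f x - l x) • v with hφ
  have hφc : ContDiffAt ℝ 1 φ x₀ :=
    contDiffAt_id.add ((hf.sub l.contDiff.contDiffAt).smul contDiffAt_const)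
  have hφd : HasFDerivAt φ ((ContinuousLinearEquiv.refl ℝ E : E ≃L[ℝ] E) : E →L[ℝ] E) x₀ := by
    have h1 := (hasFDerivAt_id x₀).add
      ((((hf.differentiableAt one_ne_zero).hasFDerivAt).sub l.hasFDerivAt).smul_const v)
    refine h1.congr_fderiv ?_
    ext w
    simp [hl]
  refine ⟨hφc.toOpenPartialHomeomorph φ hφd one_ne_zero,
    hφc.mem_toOpenPartialHomeomorph_source hφd one_ne_zero, fun x => ?_, ?_⟩
  · simp [hφ, hv]
  · have h2 := hφc.to_localInverse hφd one_ne_zero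
    filter_upwards [h2.eventually (by simp)] with y hy
    exact hy.differentiableAt one_ne_zero

variable [MeasurableSpace E] [BorelSpace E] (μ : Measure E) [μ.IsAddHaarMeasure]

theorem measure_levelSet_linearForm_eq_zero {l : E →L[ℝ] ℝ} (hl : l ≠ 0) (c : ℝ) :
    μ {x | l x = c} = 0 := by
  obtain ⟨w, hw⟩ : ∃ w, l w ≠ 0 := by
    by_contra! hcon
    exact hl (ContinuousLinearMap.ext hcon)
  have hne : AffineSubspace.mk' ((c / l w) • w) (LinearMap.ker (l : E →ₗ[ℝ] ℝ)) ≠ ⊤ := by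
    intro htop
    have : (((c / l w) + 1) • w) ∈
        AffineSubspace.mk' ((c / l w) • w) (LinearMap.ker (l : E →ₗ[ℝ] ℝ)) := by
      rw [htop]; trivial
    rw [AffineSubspace.mem_mk'] at this
    simp [add_smul, hw] at this
  refine measure_mono_null (fun x hx => ?_) (Measure.addHaar_affineSubspace μ _ hne)
  rw [mem_ofPred_eq] at hx
  simp [AffineSubspace.mem_mk', hx, hw]

/-- A flow box: arbitrarily small neighbourhoods in which the slabs of a function near a regular
point are connected, and its level sets are null. -/
theorem exists_isOpen_isPreconnected_inter_preimage {f : E → ℝ} {x₀ : E}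
    (hf : ContDiffAt ℝ 1 f x₀) (hx₀ : fderiv ℝ f x₀ ≠ 0) {N : Set E} (hN : N ∈ nhds x₀) :
    ∃ V, IsOpen V ∧ x₀ ∈ V ∧ V ⊆ N ∧
      (∀ I : Set ℝ, Convex ℝ I → IsPreconnected (V ∩ f ⁻¹' I)) ∧
      ∀ c, μ (V ∩ f ⁻¹' {c}) = 0 := by
  obtain ⟨e, hes, hel, hed⟩ := exists_localDiffeo_straightening hf hx₀
  have het : e x₀ ∈ e.target := e.map_source hes
  have hNe : ∀ᶠ y in nhds (e x₀), e.symm y ∈ N :=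
    (e.tendsto_symm hes).eventually hN
  obtain ⟨r, hr, hball⟩ := Metric.eventually_nhds_iff_ball.1
    (hed.and (hNe.and (e.open_target.eventually_mem het)))
  have hinter : ∀ I : Set ℝ, e.symm '' Metric.ball (e x₀) r ∩ f ⁻¹' I =
      e.symm '' (Metric.ball (e x₀) r ∩ fderiv ℝ f x₀ ⁻¹' I) := by
    intro I
    rw [← image_inter_preimage]
    congr 1
    ext y
    simp only [mem_inter_iff, mem_preimage, and_congr_right_iff]
    intro hy
    rw [← hel, e.right_inv (hball y hy).2.2]
  have hdiff : DifferentiableOn ℝ e.symm (Metric.ball (e x₀) r) := fun y hy =>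
    (hball y hy).1.differentiableWithinAt
  refine ⟨e.symm '' Metric.ball (e x₀) r,
    e.symm.isOpen_image_of_subset_source Metric.isOpen_ball fun y hy => (hball y hy).2.2,
    ⟨e x₀, Metric.mem_ball_self hr, e.left_inv hes⟩, ?_, fun I hI => ?_, fun c => ?_⟩
  · rintro _ ⟨y, hy, rfl⟩
    exact (hball y hy).2.1
  · rw [hinter]
    refine IsPreconnected.image ?_ _ (hdiff.continuousOn.mono inter_subset_left)
    exact ((convex_ball _ _).inter (hI.linear_preimage
      (fderiv ℝ f x₀ : E →ₗ[ℝ] ℝ))).isPreconnected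
  · rw [hinter]
    exact addHaar_image_eq_zero_of_differentiableOn_of_addHaar_eq_zero μ
      (hdiff.mono inter_subset_left)
      (measure_mono_null inter_subset_right (measure_levelSet_linearForm_eq_zero μ hx₀ c))

/-- The level sets of a submersion are null. -/
theorem measure_preimage_singleton_eq_zero {f : E → ℝ} (hf : ContDiff ℝ 1 f)
    (hf' : ∀ x, fderiv ℝ f x ≠ 0) (c : ℝ) : μ (f ⁻¹' {c}) = 0 := by
  refine measure_null_of_locally_null _ fun x _ => ?_
  obtain ⟨V, hV, hxV, -, -, hnull⟩ := exists_isOpen_isPreconnected_inter_preimage μ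
    hf.contDiffAt (hf' x) Filter.univ_mem
  exact ⟨V ∩ f ⁻¹' {c}, Filter.inter_mem (mem_nhdsWithin_of_mem_nhds (hV.mem_nhds hxV)) self_mem_nhdsWithin, hnull c⟩

/-- If the frontiers of an increasing sequence of open sets lie, outside a closed set `K`, in level
sets of a submersion, then the frontier of the union is null outside `K`. -/
theorem measure_frontier_iUnion_diff_eq_zero {f : E → ℝ} (hf : ContDiff ℝ 1 f)
    (hf' : ∀ x, fderiv ℝ f x ≠ 0) {K : Set E} (hK : IsClosed K) {P : ℕ → Set E} {c : ℕ → ℝ}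
    (hPo : ∀ k, IsOpen (P k)) (hP : Monotone P)
    (hfr : ∀ k, frontier (P k) ⊆ f ⁻¹' {c k} ∪ K) :
    μ (frontier (⋃ k, P k) \ K) = 0 := by
  refine measure_null_of_locally_null _ fun x hx => ?_
  obtain ⟨V, hV, hxV, hVK, hconn, hnull⟩ := exists_isOpen_isPreconnected_inter_preimage μ
    hf.contDiffAt (hf' x) (hK.isOpen_compl.mem_nhds hx.2)
  have hWo : IsOpen (⋃ k, P k) := isOpen_iUnion hPo
  -- a slab of `V` avoiding the level `c k` and meeting `P k` lies in `P k`
  have hslab : ∀ k (I : Set ℝ), Convex ℝ I → c k ∉ I → (V ∩ f ⁻¹' I ∩ P k).Nonempty →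
      V ∩ f ⁻¹' I ⊆ P k := by
    intro k I hI hcI hne
    refine (hconn I hI).subset_of_closure_inter_subset (hPo k) hne ?_
    rintro y ⟨hyc, hyV, hyI⟩
    by_contra hyP
    have hyf : y ∈ frontier (P k) := by
      rw [(hPo k).frontier_eq]; exact ⟨hyc, hyP⟩
    rcases hfr k hyf with h | h
    · exact hcI (by rw [← (show f y = c k from h)]; exact hyI)
    · exact hVK hyV h
  -- `f` is constant on the frontier of the union inside `V`. Otherwise take `t` strictly between
  -- two values and `k` so large that `P k` meets both slabs `f < t` and `f > t`. One of them avoids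
  -- the level `c k`, so it lies in `P k` and contains no frontier point of the union.
  have hlt : ∀ y ∈ frontier (⋃ k, P k) ∩ V, ∀ z ∈ frontier (⋃ k, P k) ∩ V, ¬ f y < f z := by
    rintro y ⟨hyF, hyV⟩ z ⟨hzF, hzV⟩ hyz
    obtain ⟨t, hyt, htz⟩ := exists_between hyz
    rw [hWo.frontier_eq] at hyF hzF
    obtain ⟨p, ⟨hpV, hpt⟩, hp⟩ := mem_closure_iff.1 hyF.1 (V ∩ f ⁻¹' Iio t)
      (hV.inter (isOpen_Iio.preimage hf.continuous)) ⟨hyV, hyt⟩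
    obtain ⟨q, ⟨hqV, hqt⟩, hq⟩ := mem_closure_iff.1 hzF.1 (V ∩ f ⁻¹' Ioi t)
      (hV.inter (isOpen_Ioi.preimage hf.continuous)) ⟨hzV, htz⟩
    obtain ⟨i, hi⟩ := mem_iUnion.1 hp
    obtain ⟨j, hj⟩ := mem_iUnion.1 hq
    rcases le_total t (c (max i j)) with hc | hc
    · exact hyF.2 (mem_iUnion.2 ⟨_, hslab (max i j) (Iio t) (convex_Iio t) (by simpa using hc)
        ⟨p, ⟨hpV, hpt⟩, hP (le_max_left i j) hi⟩ ⟨hyV, hyt⟩⟩)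
    · exact hzF.2 (mem_iUnion.2 ⟨_, hslab (max i j) (Ioi t) (convex_Ioi t) (by simpa using hc)
        ⟨q, ⟨hqV, hqt⟩, hP (le_max_right i j) hj⟩ ⟨hzV, htz⟩⟩)
  refine ⟨(frontier (⋃ k, P k) \ K) ∩ V, Filter.inter_mem self_mem_nhdsWithin
    (mem_nhdsWithin_of_mem_nhds (hV.mem_nhds hxV)), measure_mono_null ?_ (hnull (f x))⟩
  rintro y ⟨hy, hyV⟩
  exact ⟨hyV, le_antisymm (not_lt.1 (hlt x ⟨hx.1, hxV⟩ y ⟨hy.1, hyV⟩))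
    (not_lt.1 (hlt y ⟨hy.1, hyV⟩ x ⟨hx.1, hxV⟩))⟩

end LevelSets

/-! ### Determinants with one row replaced -/

section RowDet

variable {n : ℕ}

/-- The determinant of the matrix of `A` in which the row `j` is replaced by the linear form `l`. -/
noncomputable def rowDet (A : EuclideanSpace ℝ (Fin n) →L[ℝ] EuclideanSpace ℝ (Fin n)) (j : Fin n)
    (l : EuclideanSpace ℝ (Fin n) →L[ℝ] ℝ) : ℝ :=
  ((Matrix.of fun i k => A (EuclideanSpace.single k 1) i).updateRow j
    fun k => l (EuclideanSpace.single k 1)).det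

theorem det_eq_det_of_single (A : EuclideanSpace ℝ (Fin n) →L[ℝ] EuclideanSpace ℝ (Fin n)) :
    A.det = (Matrix.of fun i k => A (EuclideanSpace.single k 1) i).det := by
  rw [ContinuousLinearMap.det,
    ← LinearMap.det_toMatrix (EuclideanSpace.basisFun (Fin n) ℝ).toBasis]
  congr 1

theorem det_eq_rowDet {A B : EuclideanSpace ℝ (Fin n) →L[ℝ] EuclideanSpace ℝ (Fin n)} {j : Fin n}
    {l : EuclideanSpace ℝ (Fin n) →L[ℝ] ℝ} (hj : ∀ w, B w j = l w)
    (hi : ∀ i, i ≠ j → ∀ w, B w i = A w i) : B.det = rowDet A j l := by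
  rw [det_eq_det_of_single, rowDet]
  congr 1
  ext i k
  rcases eq_or_ne i j with rfl | h
  · simp [hj]
  · simp [h, hi i h]

theorem rowDet_add (A : EuclideanSpace ℝ (Fin n) →L[ℝ] EuclideanSpace ℝ (Fin n)) (j : Fin n)
    (l m : EuclideanSpace ℝ (Fin n) →L[ℝ] ℝ) :
    rowDet A j (l + m) = rowDet A j l + rowDet A j m :=
  Matrix.det_updateRow_add _ j (fun k => l (EuclideanSpace.single k 1))
    fun k => m (EuclideanSpace.single k 1)

theorem rowDet_smul (A : EuclideanSpace ℝ (Fin n) →L[ℝ] EuclideanSpace ℝ (Fin n)) (j : Fin n)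
    (a : ℝ) (l : EuclideanSpace ℝ (Fin n) →L[ℝ] ℝ) :
    rowDet A j (a • l) = a * rowDet A j l :=
  Matrix.det_updateRow_smul _ j a fun k => l (EuclideanSpace.single k 1)

@[simp]
theorem rowDet_zero (A : EuclideanSpace ℝ (Fin n) →L[ℝ] EuclideanSpace ℝ (Fin n)) (j : Fin n) :
    rowDet A j 0 = 0 := by
  simpa using rowDet_smul A j 0 0

/-- Two rows coincide. This is the algebraic form of `df ∧ df = 0`, which removes the contribution
of the level set. -/
theorem rowDet_proj_comp_of_ne (A : EuclideanSpace ℝ (Fin n) →L[ℝ] EuclideanSpace ℝ (Fin n))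
    {i j : Fin n} (hij : i ≠ j) : rowDet A j (EuclideanSpace.proj i ∘L A) = 0 := by
  refine Matrix.det_zero_of_row_eq hij ?_
  ext k
  simp [Matrix.updateRow_ne hij]

theorem rowDet_proj_comp_self (A : EuclideanSpace ℝ (Fin n) →L[ℝ] EuclideanSpace ℝ (Fin n))
    (j : Fin n) : rowDet A j (EuclideanSpace.proj j ∘L A) = A.det :=
  (det_eq_rowDet (fun _ => rfl) fun _ _ _ => rfl).symm

theorem ContinuousOn.rowDet {X : Type*} [TopologicalSpace X] {s : Set X}
    {A : X → EuclideanSpace ℝ (Fin n) →L[ℝ] EuclideanSpace ℝ (Fin n)} (hA : ContinuousOn A s)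
    (j : Fin n) {l : X → EuclideanSpace ℝ (Fin n) →L[ℝ] ℝ} (hl : ContinuousOn l s) :
    ContinuousOn (fun x => rowDet (A x) j (l x)) s := by
  have h : Continuous fun M : Matrix (Fin n) (Fin n) ℝ => M.det := continuous_id.matrix_det
  refine h.comp_continuousOn (continuousOn_pi.2 fun i => continuousOn_pi.2 fun k => ?_)
  rcases eq_or_ne i j with rfl | hij
  · simp only [Matrix.updateRow_self]
    exact hl.clm_apply continuousOn_const
  · simp only [Matrix.updateRow_ne hij, Matrix.of_apply]
    exact (EuclideanSpace.proj (𝕜 := ℝ) i).continuous.comp_continuousOn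
      (hA.clm_apply continuousOn_const)

end RowDet

/-! ### Smooth cutoffs -/

section Cutoff

variable {E : Type*} [NormedAddCommGroup E] [NormedSpace ℝ E]

theorem contDiff_of_contDiffAt_tsupport {F : Type*} [NormedAddCommGroup F] [NormedSpace ℝ F]
    {k : WithTop ℕ∞} {g : E → F} (hg : ∀ x ∈ tsupport g, ContDiffAt ℝ k g x) : ContDiff ℝ k g :=
  contDiff_iff_contDiffAt.2 fun x => by
    by_cases hx : x ∈ tsupport g
    · exact hg x hx
    · exact contDiffAt_const.congr_of_eventuallyEq (notMem_tsupport_iff_eventuallyEq.1 hx)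

variable [FiniteDimensional ℝ E]

theorem exists_contDiff_cutoff {K U : Set E} (hK : IsCompact K) (hU : IsOpen U) (hKU : K ⊆ U) :
    ∃ χ : E → ℝ, ContDiff ℝ ∞ χ ∧ HasCompactSupport χ ∧ tsupport χ ⊆ U ∧
      (∀ x ∈ K, ∀ᶠ y in nhds x, χ y = 1) ∧ ∀ x, χ x ∈ Icc (0 : ℝ) 1 := by
  obtain ⟨L, hL, hKL, hLU⟩ := exists_compact_between hK hU hKU
  obtain ⟨χ, h1, h0, h01⟩ := exists_contMDiffMap_one_nhds_of_subset_interior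
    (n := ⊤) (modelWithCornersSelf ℝ E) hK.isClosed hKL
  have hsup : tsupport χ ⊆ L := closure_minimal (fun x hx => by
    by_contra hxL
    exact hx (h0 x hxL)) hL.isClosed
  refine ⟨χ, χ.contMDiff.contDiff, hL.of_isClosed_subset (isClosed_tsupport _) hsup,
    hsup.trans hLU, fun x hx => ?_, h01⟩
  exact h1.filter_mono (nhds_le_nhdsSet hx)

end Cutoff

/-! ### Integration by parts -/

section Stokes

variable {n : ℕ} {F : EuclideanSpace ℝ (Fin n) → EuclideanSpace ℝ (Fin n)}
  {U : Set (EuclideanSpace ℝ (Fin n))}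

/-- The integrand is the Jacobian of a compactly supported self-map: cut `F` off by `θ`, equal to
`1` near the support of `v`, and put `v` in place of its component `j`. Off the support of `v` both
determinants vanish. -/
theorem integral_rowDet_fderiv_eq_zero (hU : IsOpen U) (hF : ContDiffOn ℝ 1 F U) (j : Fin n)
    {v : EuclideanSpace ℝ (Fin n) → ℝ} (hv : ContDiff ℝ 1 v) (hvc : HasCompactSupport v)
    (hvU : tsupport v ⊆ U) :
    ∫ x, rowDet (fderiv ℝ F x) j (fderiv ℝ v x) = 0 := by
  obtain ⟨θ, hθ, hθc, hθU, hθ1, -⟩ := exists_contDiff_cutoff hvc hU hvU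
  have hH : ContDiff ℝ 1 (fun x => θ x • F x) := by
    refine contDiff_of_contDiffAt_tsupport fun x hx => ?_
    have hxU : x ∈ U := hθU (tsupport_smul_subset_left θ F hx)
    exact (hθ.of_le (by simp)).contDiffAt.smul (hF.contDiffAt (hU.mem_nhds hxU))
  set H := fun x => θ x • F x with hHdef
  set G := fun x => H x + (v x - H x j) • EuclideanSpace.single j (1 : ℝ) with hGdef
  have hHj : ContDiff ℝ 1 (fun x => H x j) :=
    (EuclideanSpace.proj (𝕜 := ℝ) j).contDiff.comp hH
  have hG : ContDiff ℝ 1 G := hH.add ((hv.sub hHj).smul contDiff_const)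
  have hGc : HasCompactSupport G := by
    refine HasCompactSupport.intro (hθc.isCompact.union hvc.isCompact) fun x hx => ?_
    rw [mem_union, not_or] at hx
    simp [hGdef, hHdef, image_eq_zero_of_notMem_tsupport hx.1,
      image_eq_zero_of_notMem_tsupport hx.2]
  have hcoord : ∀ x i w, fderiv ℝ G x w i = fderiv ℝ (fun y => G y i) x w := by
    intro x i w
    have := ((EuclideanSpace.proj (𝕜 := ℝ) i).hasFDerivAt.comp x
      (hG.differentiable one_ne_zero x).hasFDerivAt).fderiv
    exact (congrArg (fun A => A w) this).symm
  have hcoordH : ∀ x i w, fderiv ℝ H x w i = fderiv ℝ (fun y => H y i) x w := by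
    intro x i w
    have := ((EuclideanSpace.proj (𝕜 := ℝ) i).hasFDerivAt.comp x
      (hH.differentiable one_ne_zero x).hasFDerivAt).fderiv
    exact (congrArg (fun A => A w) this).symm
  have hdet : ∀ x, (fderiv ℝ G x).det = rowDet (fderiv ℝ F x) j (fderiv ℝ v x) := by
    intro x
    have h1 : (fderiv ℝ G x).det = rowDet (fderiv ℝ H x) j (fderiv ℝ v x) := by
      refine det_eq_rowDet (fun w => ?_) fun i hij w => ?_
      · rw [hcoord]
        congr 2
        ext y
        simp [hGdef]
      · rw [hcoord, hcoordH]
        congr 2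
        ext y
        simp [hGdef, hij]
    rw [h1]
    by_cases hx : x ∈ tsupport v
    · have : H =ᶠ[nhds x] F := by
        filter_upwards [hθ1 x hx] with y hy
        simp [hHdef, hy]
      rw [this.fderiv_eq]
    · have : fderiv ℝ v x = 0 := by
        by_contra hne
        exact hx (support_fderiv_subset ℝ hne)
      simp [this]
  have hpos : 0 < Module.finrank ℝ (EuclideanSpace ℝ (Fin n)) := by
    rw [finrank_euclideanSpace_fin]
    exact j.pos
  rw [← integral_det_fderiv_eq_zero volume hpos hG hGc]
  exact integral_congr_ae (Filter.Eventually.of_forall fun x => (hdet x).symm)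

/-- Integration by parts for Jacobian determinants. -/
theorem integral_mul_det_fderiv_add_eq_zero (hU : IsOpen U) (hF : ContDiffOn ℝ 1 F U) (j : Fin n)
    {u : EuclideanSpace ℝ (Fin n) → ℝ} (hu : ContDiff ℝ 1 u) (huc : HasCompactSupport u)
    (huU : tsupport u ⊆ U) :
    ∫ x, (u x * (fderiv ℝ F x).det + F x j * rowDet (fderiv ℝ F x) j (fderiv ℝ u x)) = 0 := by
  have hFj : ContDiffOn ℝ 1 (fun x => F x j) U :=
    (EuclideanSpace.proj (𝕜 := ℝ) j).contDiff.comp_contDiffOn hF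
  have hsub : tsupport (fun x => u x * F x j) ⊆ tsupport u := tsupport_mul_subset_left
  have hv : ContDiff ℝ 1 (fun x => u x * F x j) := by
    refine contDiff_of_contDiffAt_tsupport fun x hx => ?_
    exact hu.contDiffAt.mul (hFj.contDiffAt (hU.mem_nhds (huU (hsub hx))))
  rw [← integral_rowDet_fderiv_eq_zero hU hF j hv huc.mul_right (hsub.trans huU)]
  refine integral_congr_ae (Filter.Eventually.of_forall fun x => ?_)
  by_cases hx : x ∈ tsupport u
  · have hxU := hU.mem_nhds (huU hx)
    have hd := (hF.contDiffAt hxU).differentiableAt one_ne_zero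
    have hdj : HasFDerivAt (fun x => F x j) (EuclideanSpace.proj j ∘L fderiv ℝ F x) x :=
      (EuclideanSpace.proj (𝕜 := ℝ) j).hasFDerivAt.comp x hd.hasFDerivAt
    have hd' : fderiv ℝ (fun x => u x * F x j) x = u x • (EuclideanSpace.proj j ∘L fderiv ℝ F x) +
        F x j • fderiv ℝ u x := (((hu.differentiable one_ne_zero) x).hasFDerivAt.mul hdj).fderiv
    beta_reduce
    rw [hd', rowDet_add, rowDet_smul, rowDet_smul, rowDet_proj_comp_self]
  · have h1 : fderiv ℝ u x = 0 := by
      by_contra hne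
      exact hx (support_fderiv_subset ℝ hne)
    have h2 : fderiv ℝ (fun x => u x * F x j) x = 0 := by
      by_contra hne
      exact hx (hsub (support_fderiv_subset ℝ hne))
    simp [h1, h2, image_eq_zero_of_notMem_tsupport hx]

end Stokes

/-! ### The uniform bound -/

section Estimate

variable {n : ℕ}

theorem lintegral_ofReal_le_of_integral_add_eq_zero {α : Type*} [MeasurableSpace α]
    {μ : Measure α} {a b m : α → ℝ} (ha : Integrable a μ) (ha0 : 0 ≤ a) (hb : Integrable b μ)
    (hm : Integrable m μ) (hbm : ∀ x, -b x ≤ m x) (hab : ∫ x, (a x + b x) ∂μ = 0) :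
    ∫⁻ x, ENNReal.ofReal (a x) ∂μ ≤ ENNReal.ofReal (∫ x, m x ∂μ) := by
  rw [← ofReal_integral_eq_lintegral_ofReal ha (Filter.Eventually.of_forall ha0)]
  refine ENNReal.ofReal_le_ofReal ?_
  rw [integral_add ha hb] at hab
  calc ∫ x, a x ∂μ = ∫ x, -b x ∂μ := by rw [integral_neg]; linarith
    _ ≤ ∫ x, m x ∂μ := integral_mono hb.neg hm hbm

/-- A smooth step function: it vanishes near `c` and equals `1` where `2 ≤ m * (t - c) ^ 2`. -/
theorem exists_contDiff_eq_zero_near (c : ℝ) (m : ℕ) :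
    ∃ ψ : ℝ → ℝ, ContDiff ℝ ∞ ψ ∧ (∀ t, ψ t ∈ Icc (0 : ℝ) 1) ∧ (∀ᶠ t in nhds c, ψ t = 0) ∧
      ∀ t, 2 ≤ m * (t - c) ^ 2 → ψ t = 1 := by
  refine ⟨fun t => Real.smoothTransition (m * (t - c) ^ 2 - 1),
    Real.smoothTransition.contDiff.comp (by fun_prop),
    fun t => ⟨Real.smoothTransition.nonneg _, Real.smoothTransition.le_one _⟩, ?_, fun t ht =>
      Real.smoothTransition.one_of_one_le (by linarith)⟩
  have hc : Continuous fun t : ℝ => m * (t - c) ^ 2 - 1 := by fun_prop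
  have : ∀ᶠ t in nhds c, m * (t - c) ^ 2 - 1 < 0 :=
    (hc.tendsto c).eventually (gt_mem_nhds (by simp))
  filter_upwards [this] with t ht
  exact Real.smoothTransition.zero_of_nonpos ht.le

theorem integrable_of_continuousOn_of_compact_support {X : Type*} [TopologicalSpace X]
    [T2Space X] [MeasurableSpace X] [BorelSpace X] {μ : Measure X} [IsFiniteMeasureOnCompacts μ]
    {g : X → ℝ} {S : Set X} (hS : IsCompact S) (hg : ContinuousOn g S) (h0 : ∀ x ∉ S, g x = 0) :
    Integrable g μ :=
  (integrableOn_iff_integrable_of_support_subset fun x hx => by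
    by_contra hxS
    exact hx (h0 x hxS)).1 (hg.integrableOn_compact hS)

variable {F : EuclideanSpace ℝ (Fin n) → EuclideanSpace ℝ (Fin n)}
  {U : Set (EuclideanSpace ℝ (Fin n))}

theorem continuousOn_det_fderiv (hU : IsOpen U) (hF : ContDiffOn ℝ 1 F U) :
    ContinuousOn (fun x => (fderiv ℝ F x).det) U :=
  ContinuousLinearMap.continuous_det.comp_continuousOn
    (hF.continuousOn_fderiv_of_isOpen hU le_rfl)

/-- Away from the support of a cutoff `χ`, the integral of a nonnegative Jacobian determinant
over an open set bounded by a level set of the component `f` of `F` and by a part of `{χ = 1}`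
is bounded by a quantity which does not depend on the open set. -/
theorem lintegral_one_sub_mul_det_le (hU : IsOpen U) (hF : ContDiffOn ℝ 1 F U) {i j : Fin n}
    (hij : i ≠ j) {f : EuclideanSpace ℝ (Fin n) → ℝ} (hf : ContDiff ℝ 1 f)
    (hFf : ∀ x ∈ U, F x i = f x) (hdet : ∀ x ∈ U, 0 ≤ (fderiv ℝ F x).det)
    {χ : EuclideanSpace ℝ (Fin n) → ℝ} (hχ : ContDiff ℝ 1 χ) (hχc : HasCompactSupport χ)
    (hχU : tsupport χ ⊆ U) (hχ01 : ∀ x, χ x ∈ Icc (0 : ℝ) 1)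
    {P : Set (EuclideanSpace ℝ (Fin n))} (hPo : IsOpen P) (hPb : Bornology.IsBounded P)
    (hPU : closure P ⊆ U) {c : ℝ}
    (hfr : ∀ x ∈ frontier P, f x = c ∨ ∀ᶠ y in nhds x, χ y = 1) (m : ℕ) :
    ∫⁻ x in P ∩ {x | 2 ≤ m * (f x - c) ^ 2}, ENNReal.ofReal ((1 - χ x) * (fderiv ℝ F x).det) ≤
      ENNReal.ofReal (∫ x, |F x j * rowDet (fderiv ℝ F x) j (fderiv ℝ χ x)|) := by
  classical
  obtain ⟨ψ, hψ, hψ01, hψ0, hψ1⟩ := exists_contDiff_eq_zero_near c m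
  replace hψ : ContDiff ℝ 1 ψ := hψ.of_le (by simp)
  -- Near each frontier point of `P` one of the two factors vanishes identically, so cutting `w` off
  -- sharply at `P` keeps it `C¹`.
  set w : EuclideanSpace ℝ (Fin n) → ℝ := fun x => (1 - χ x) * ψ (f x) with hw
  set u : EuclideanSpace ℝ (Fin n) → ℝ := P.indicator w with hu
  have hwd : ContDiff ℝ 1 w := (contDiff_const.sub hχ).mul (hψ.comp hf)
  have hloc : ∀ x, u =ᶠ[nhds x] 0 ∨ (x ∈ P ∧ u =ᶠ[nhds x] w) := by
    intro x
    by_cases hxP : x ∈ P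
    · refine Or.inr ⟨hxP, ?_⟩
      filter_upwards [hPo.mem_nhds hxP] with y hy
      exact indicator_of_mem hy w
    left
    by_cases hxc : x ∈ closure P
    · have hxf : x ∈ frontier P := by rw [hPo.frontier_eq]; exact ⟨hxc, hxP⟩
      have hw0 : ∀ᶠ y in nhds x, w y = 0 := by
        rcases hfr x hxf with h | h
        · have := (hf.continuous.tendsto x).eventually (by rw [h]; exact hψ0)
          filter_upwards [this] with y hy
          simp [hw, hy]
        · filter_upwards [h] with y hy
          simp [hw, hy]
      filter_upwards [hw0] with y hy
      by_cases hyP : y ∈ P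
      · rw [hu, indicator_of_mem hyP, hy]; rfl
      · rw [hu, indicator_of_notMem hyP]; rfl
    · filter_upwards [isClosed_closure.isOpen_compl.mem_nhds hxc] with y hy
      exact indicator_of_notMem (fun h => hy (subset_closure h)) w
  have hud : ContDiff ℝ 1 u := contDiff_iff_contDiffAt.2 fun x => by
    rcases hloc x with h | ⟨-, h⟩
    · exact contDiffAt_const.congr_of_eventuallyEq h
    · exact hwd.contDiffAt.congr_of_eventuallyEq h
  have hPc : IsCompact (closure P) := hPb.isCompact_closure
  have husub : tsupport u ⊆ closure P := closure_mono support_indicator_subset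
  have huc : HasCompactSupport u := hPc.of_isClosed_subset (isClosed_tsupport u) husub
  have huU : tsupport u ⊆ U := husub.trans hPU
  have hu0 : ∀ x, 0 ≤ u x := fun x =>
    indicator_nonneg (fun y _ => mul_nonneg (sub_nonneg.2 (hχ01 y).2) (hψ01 _).1) x
  -- On `P`, `dw = (1 - χ) ψ'(f) df - ψ(f) dχ`. As `df` is the row `i ≠ j` of `DF`, the term with
  -- `ψ'`, which is not controlled as `m` grows, drops out.
  have hrow : ∀ x, rowDet (fderiv ℝ F x) j (fderiv ℝ u x) =
      -(P.indicator (fun x => ψ (f x)) x * rowDet (fderiv ℝ F x) j (fderiv ℝ χ x)) := by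
    intro x
    rcases hloc x with h | ⟨hxP, h⟩
    · have hu' : fderiv ℝ u x = 0 := by
        rw [h.fderiv_eq]; exact (hasFDerivAt_const (0 : ℝ) x).fderiv
      rw [hu', rowDet_zero, eq_comm, neg_eq_zero, mul_eq_zero]
      by_cases hxP : x ∈ P
      · by_cases hψx : ψ (f x) = 0
        · left; simp [hψx]
        · right
          -- here `χ = 1` near `x`
          have h1 : χ =ᶠ[nhds x] fun _ => 1 := by
            have hne : ∀ᶠ y in nhds x, ψ (f y) ≠ 0 :=
              ((hψ.continuous.comp hf.continuous).tendsto x).eventually_ne hψx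
            filter_upwards [h, hne, hPo.mem_nhds hxP] with y hy hy' hyP
            rw [hu, indicator_of_mem hyP] at hy
            rcases mul_eq_zero.1 hy with h' | h'
            · linarith
            · exact absurd h' hy'
          rw [h1.fderiv_eq, (hasFDerivAt_const (1 : ℝ) x).fderiv, rowDet_zero]
      · left; exact indicator_of_notMem hxP _
    · have hxU := hU.mem_nhds (hPU (subset_closure hxP))
      have hFd := (hF.contDiffAt hxU).differentiableAt one_ne_zero
      have hf' : fderiv ℝ f x = EuclideanSpace.proj i ∘L fderiv ℝ F x := by
        have h1 : HasFDerivAt (fun x => F x i) (EuclideanSpace.proj i ∘L fderiv ℝ F x) x :=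
          (EuclideanSpace.proj (𝕜 := ℝ) i).hasFDerivAt.comp x hFd.hasFDerivAt
        refine (h1.congr_of_eventuallyEq ?_).fderiv
        filter_upwards [hxU] with y hy
        exact (hFf y hy).symm
      have hψf : HasFDerivAt (fun y => ψ (f y)) (deriv ψ (f x) • fderiv ℝ f x) x :=
        ((hψ.differentiable one_ne_zero _).hasDerivAt).comp_hasFDerivAt x
          (hf.differentiable one_ne_zero x).hasFDerivAt
      have hw' : fderiv ℝ w x = (1 - χ x) • (deriv ψ (f x) • fderiv ℝ f x) +
          ψ (f x) • ((-1 : ℝ) • fderiv ℝ χ x) := by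
        have h1 : HasFDerivAt (fun y => 1 - χ y) ((-1 : ℝ) • fderiv ℝ χ x) x := by
          simpa using (hχ.differentiable one_ne_zero x).hasFDerivAt.const_sub 1
        exact (h1.mul hψf).fderiv
      rw [h.fderiv_eq, hw', rowDet_add, rowDet_smul, rowDet_smul, rowDet_smul, rowDet_smul, hf',
        rowDet_proj_comp_of_ne _ hij, indicator_of_mem hxP]
      ring
  have hDF : ContinuousOn (fderiv ℝ F) U := hF.continuousOn_fderiv_of_isOpen hU le_rfl
  have hFj : ContinuousOn (fun x => F x j) U :=
    (EuclideanSpace.proj (𝕜 := ℝ) j).continuous.comp_continuousOn hF.continuousOn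
  have hM : ContinuousOn (fun x => F x j * rowDet (fderiv ℝ F x) j (fderiv ℝ χ x)) U :=
    hFj.mul (hDF.rowDet j (hχ.continuous_fderiv one_ne_zero).continuousOn)
  have hMi : Integrable (fun x => |F x j * rowDet (fderiv ℝ F x) j (fderiv ℝ χ x)|)
      (volume : Measure (EuclideanSpace ℝ (Fin n))) := by
    refine integrable_of_continuousOn_of_compact_support hχc.isCompact (hM.mono hχU).abs
      fun x hx => ?_
    have : fderiv ℝ χ x = 0 := by
      by_contra hne
      exact hx (support_fderiv_subset ℝ hne)
    simp [this]
  have ha : Integrable (fun x => u x * (fderiv ℝ F x).det)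
      (volume : Measure (EuclideanSpace ℝ (Fin n))) :=
    integrable_of_continuousOn_of_compact_support huc.isCompact
      (hud.continuous.continuousOn.mul ((continuousOn_det_fderiv hU hF).mono huU))
      fun x hx => by simp [image_eq_zero_of_notMem_tsupport hx]
  have hb : Integrable (fun x => F x j * rowDet (fderiv ℝ F x) j (fderiv ℝ u x))
      (volume : Measure (EuclideanSpace ℝ (Fin n))) := by
    refine integrable_of_continuousOn_of_compact_support huc.isCompact
      ((hFj.mul (hDF.rowDet j (hud.continuous_fderiv one_ne_zero).continuousOn)).mono huU)
      fun x hx => ?_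
    have : fderiv ℝ u x = 0 := by
      by_contra hne
      exact hx (support_fderiv_subset ℝ hne)
    simp [this]
  have ha0 : ∀ x, 0 ≤ u x * (fderiv ℝ F x).det := fun x => by
    by_cases hx : x ∈ tsupport u
    · exact mul_nonneg (hu0 x) (hdet x (huU hx))
    · simp [image_eq_zero_of_notMem_tsupport hx]
  have hbm : ∀ x, -(F x j * rowDet (fderiv ℝ F x) j (fderiv ℝ u x)) ≤
      |F x j * rowDet (fderiv ℝ F x) j (fderiv ℝ χ x)| := fun x => by
    have hI : P.indicator (fun x => ψ (f x)) x ∈ Icc (0 : ℝ) 1 := by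
      by_cases hxP : x ∈ P
      · rw [indicator_of_mem hxP]; exact hψ01 _
      · rw [indicator_of_notMem hxP]; simp
    rw [hrow]
    calc -(F x j * -(P.indicator (fun x => ψ (f x)) x * rowDet (fderiv ℝ F x) j (fderiv ℝ χ x)))
        = P.indicator (fun x => ψ (f x)) x *
          (F x j * rowDet (fderiv ℝ F x) j (fderiv ℝ χ x)) := by ring
      _ ≤ P.indicator (fun x => ψ (f x)) x *
          |F x j * rowDet (fderiv ℝ F x) j (fderiv ℝ χ x)| :=
        mul_le_mul_of_nonneg_left (le_abs_self _) hI.1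
      _ ≤ _ := mul_le_of_le_one_left (abs_nonneg _) hI.2
  refine le_trans ?_ (lintegral_ofReal_le_of_integral_add_eq_zero ha ha0 hb hMi hbm
    (integral_mul_det_fderiv_add_eq_zero hU hF j hud huc huU))
  have hmeas : MeasurableSet (P ∩ {x | 2 ≤ m * (f x - c) ^ 2}) :=
    hPo.measurableSet.inter (isClosed_le continuous_const
      (by have := hf.continuous; fun_prop)).measurableSet
  refine le_trans (le_of_eq (setLIntegral_congr_fun hmeas fun x hx => ?_))
    (setLIntegral_le_lintegral _ _)
  simp only [hu, indicator_of_mem hx.1, hw, hψ1 _ hx.2, mul_one]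

/-- The integral of a nonnegative Jacobian determinant over bounded open sets whose frontiers
lie in a level set of a component of the map and in a fixed compact set is uniformly bounded. -/
theorem exists_lintegral_det_le (hU : IsOpen U) (hF : ContDiffOn ℝ 1 F U) {i j : Fin n}
    (hij : i ≠ j) {f : EuclideanSpace ℝ (Fin n) → ℝ} (hf : ContDiff ℝ 1 f)
    (hf' : ∀ x, fderiv ℝ f x ≠ 0)
    (hFf : ∀ x ∈ U, F x i = f x) (hdet : ∀ x ∈ U, 0 ≤ (fderiv ℝ F x).det)
    {K : Set (EuclideanSpace ℝ (Fin n))} (hK : IsCompact K) (hKU : K ⊆ U) :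
    ∃ C < (⊤ : ENNReal), ∀ (P : Set (EuclideanSpace ℝ (Fin n))) (c : ℝ), IsOpen P →
      Bornology.IsBounded P → closure P ⊆ U → frontier P ⊆ f ⁻¹' {c} ∪ K →
      ∫⁻ x in P, ENNReal.ofReal (fderiv ℝ F x).det ≤ C := by
  obtain ⟨χ, hχ, hχc, hχU, hχ1, hχ01⟩ := exists_contDiff_cutoff hK hU hKU
  replace hχ : ContDiff ℝ 1 χ := hχ.of_le (by simp)
  have hJ := continuousOn_det_fderiv hU hF
  refine ⟨ENNReal.ofReal (∫ x, |F x j * rowDet (fderiv ℝ F x) j (fderiv ℝ χ x)|) +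
    ∫⁻ x in tsupport χ, ENNReal.ofReal (fderiv ℝ F x).det, ?_, fun P c hPo hPb hPU hfr => ?_⟩
  · refine ENNReal.add_lt_top.2 ⟨ENNReal.ofReal_lt_top, ?_⟩
    exact ((hJ.mono hχU).integrableOn_compact hχc.isCompact).lintegral_lt_top
  -- These sets exhaust `P` up to the null level set of `c`, and the bound over each of them is
  -- independent of `m`.
  set A : ℕ → Set (EuclideanSpace ℝ (Fin n)) := fun m => P ∩ {x | 2 ≤ m * (f x - c) ^ 2} with hA
  have hmono : Monotone A := by
    rintro a b hab x ⟨hxP, hx⟩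
    refine ⟨hxP, ?_⟩
    rw [mem_ofPred_eq] at hx ⊢
    exact hx.trans (mul_le_mul_of_nonneg_right (Nat.cast_le.2 hab) (sq_nonneg _))
  have hcover : P ⊆ (⋃ m, A m) ∪ f ⁻¹' {c} := by
    intro x hx
    by_cases hxc : f x = c
    · exact Or.inr hxc
    · left
      have hpos : 0 < (f x - c) ^ 2 := by
        have := sub_ne_zero.2 hxc
        positivity
      obtain ⟨m, hm⟩ := exists_nat_ge (2 / (f x - c) ^ 2)
      exact mem_iUnion.2 ⟨m, hx, by rwa [mem_ofPred_eq, ← div_le_iff₀ hpos]⟩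
  have hfirst : ∫⁻ x in P, ENNReal.ofReal ((1 - χ x) * (fderiv ℝ F x).det) ≤
      ENNReal.ofReal (∫ x, |F x j * rowDet (fderiv ℝ F x) j (fderiv ℝ χ x)|) := by
    refine (lintegral_mono_set hcover).trans ((lintegral_union_le _ _ _).trans ?_)
    rw [setLIntegral_measure_zero _ _ (measure_preimage_singleton_eq_zero volume hf hf' c),
      add_zero, setLIntegral_iUnion_of_directed _ hmono.directed_le]
    refine iSup_le fun m => lintegral_one_sub_mul_det_le hU hF hij hf hFf hdet hχ hχc hχU hχ01
      hPo hPb hPU (fun x hx => ?_) m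
    exact (hfr hx).imp id (hχ1 x)
  have hsplit : ∀ x ∈ P, ENNReal.ofReal (fderiv ℝ F x).det ≤
      ENNReal.ofReal ((1 - χ x) * (fderiv ℝ F x).det) +
        (tsupport χ).indicator (fun x => ENNReal.ofReal (fderiv ℝ F x).det) x := by
    intro x hxP
    have hx0 := hdet x (hPU (subset_closure hxP))
    by_cases hx : x ∈ tsupport χ
    · rw [indicator_of_mem hx]
      exact le_add_self
    · rw [image_eq_zero_of_notMem_tsupport hx]
      simp
  have hts : MeasurableSet (tsupport χ) := (isClosed_tsupport χ).measurableSet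
  have hmeas1 : AEMeasurable (fun x => ENNReal.ofReal ((1 - χ x) * (fderiv ℝ F x).det))
      (volume.restrict P) :=
    (((continuous_const.sub hχ.continuous).continuousOn.mul
      (hJ.mono (subset_closure.trans hPU))).aemeasurable hPo.measurableSet).ennreal_ofReal
  calc ∫⁻ x in P, ENNReal.ofReal (fderiv ℝ F x).det
      ≤ ∫⁻ x in P, (ENNReal.ofReal ((1 - χ x) * (fderiv ℝ F x).det) +
        (tsupport χ).indicator (fun x => ENNReal.ofReal (fderiv ℝ F x).det) x) :=
        setLIntegral_mono' hPo.measurableSet hsplit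
    _ = (∫⁻ x in P, ENNReal.ofReal ((1 - χ x) * (fderiv ℝ F x).det)) +
        ∫⁻ x in P, (tsupport χ).indicator (fun x => ENNReal.ofReal (fderiv ℝ F x).det) x :=
        lintegral_add_left' hmeas1 _
    _ ≤ _ := by
        refine add_le_add hfirst ((setLIntegral_le_lintegral _ _).trans ?_)
        rw [lintegral_indicator hts]

end Estimate

/-! ### The theorem -/

theorem theoremC (n : ℕ) (hn : 2 ≤ n)
    (f : EuclideanSpace ℝ (Fin n) → ℝ) (hf : IsSmoothSubmersion f)
    (B : Set (EuclideanSpace ℝ (Fin n))) (hB : IsMildHalfReebComponent f B)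
    (U : Set (EuclideanSpace ℝ (Fin n))) (hU : IsOpen U) (hBU : B ⊆ U)
    (h : EuclideanSpace ℝ (Fin n) → ℝ) (hh : ContDiffOn ℝ ∞ h U) (h_nonneg : ∀ x ∈ U, 0 ≤ h x)
    (h_int : ∫⁻ x in B, ENNReal.ofReal (h x) = ⊤) :
    ¬ ∃ F : EuclideanSpace ℝ (Fin n) → EuclideanSpace ℝ (Fin n),
      ContDiffOn ℝ ∞ F U ∧ (∀ x ∈ U, F x ⟨0, by omega⟩ = f x) ∧
        ∀ x ∈ U, (fderiv ℝ F x).det = h x := by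
  rintro ⟨F, hF, hFf, hFh⟩
  obtain ⟨P, Q, L, L', hBeq, hP, -, hfr, hQ, -, hPmono, -, hL'b, hL⟩ := hB
  have hF1 : ContDiffOn ℝ 1 F U := hF.of_le (by simp)
  have hf1 : ContDiff ℝ 1 f := hf.1.of_le (by simp)
  have hf' : ∀ x, fderiv ℝ f x ≠ 0 := fun x hx => by
    obtain ⟨v, hv⟩ := hf.2 x 1
    simp [hx] at hv
  have hdet : ∀ x ∈ U, 0 ≤ (fderiv ℝ F x).det := fun x hx => (hFh x hx).symm ▸ h_nonneg x hx
  have hBc : IsClosed B := hBeq ▸ isClosed_closure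
  have hPB : ∀ k, closure (P k) ⊆ B := fun k =>
    hBeq ▸ closure_mono (subset_iUnion P k)
  -- Compact because every `L k` lies in the bounded set `L'`, and contained in `B`, hence in `U`,
  -- where `F` is defined.
  set K := closure (⋃ k, L k) with hKdef
  have hK : IsCompact K := (hL'b.subset (iUnion_subset fun k => (hL k).2)).isCompact_closure
  have hKB : K ⊆ B := closure_minimal (iUnion_subset fun k => fun x hx =>
    hPB k (frontier_subset_closure ((hfr k).symm ▸ Or.inr hx))) hBc
  have hlevel : ∀ k, ∃ c, Q k ⊆ f ⁻¹' {c} := fun k => by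
    obtain ⟨_, ⟨x, rfl⟩, hQk⟩ := hQ k
    exact ⟨f x, hQk.trans (connectedComponentIn_subset _ _)⟩
  choose c hc using hlevel
  have hfr' : ∀ k, frontier (P k) ⊆ f ⁻¹' {c k} ∪ K := fun k => by
    rw [hfr k]
    exact union_subset_union (hc k) ((subset_iUnion L k).trans subset_closure)
  have hPm : Monotone P := monotone_nat_of_le_succ hPmono
  have h01 : (⟨0, by omega⟩ : Fin n) ≠ ⟨1, by omega⟩ := by simp
  obtain ⟨C, hC, hbound⟩ := exists_lintegral_det_le hU hF1 h01 hf1 hf' hFf hdet hK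
    (hKB.trans hBU)
  -- `K` need not be shown null: the continuous Jacobian is integrable over it by compactness.
  have hBsub : B ⊆ (⋃ k, P k) ∪ ((frontier (⋃ k, P k) \ K) ∪ K) := by
    rw [hBeq, closure_eq_self_union_frontier]
    exact union_subset_union_right _ fun x hx => by
      by_cases hxK : x ∈ K
      · exact Or.inr hxK
      · exact Or.inl ⟨hx, hxK⟩
  have hnull := measure_frontier_iUnion_diff_eq_zero volume hf1 hf' hK.isClosed
    (fun k => (hP k).2.2) hPm hfr'
  refine absurd h_int (ne_of_lt ?_)
  rw [← setLIntegral_congr_fun hBc.measurableSet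
    fun x hx => congrArg ENNReal.ofReal (hFh x (hBU hx))]
  refine (lintegral_mono_set hBsub).trans_lt ((lintegral_union_le _ _ _).trans_lt
    (ENNReal.add_lt_top.2 ⟨?_, (lintegral_union_le _ _ _).trans_lt
      (ENNReal.add_lt_top.2 ⟨?_, ?_⟩)⟩))
  · rw [setLIntegral_iUnion_of_directed _ hPm.directed_le]
    exact (iSup_le fun k => hbound (P k) (c k) (hP k).2.2 (hP k).1 ((hPB k).trans hBU)
      (hfr' k)).trans_lt hC
  · rw [setLIntegral_measure_zero _ _ hnull]
    exact ENNReal.zero_lt_top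
  · exact (((continuousOn_det_fderiv hU hF1).mono (hKB.trans hBU)).integrableOn_compact
      hK).lintegral_lt_top
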